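/- Let $\mathcal H$ be a complex separable Hilbert space, with inner product linear in the second argument, and let $T$ be a positive, possibly unbounded, self-adjoint operator on $\mathcal H$ (positive means $\langle\psi,T\psi\rangle\ge 0$ for all $\psi\in D(T)$). Let $\mathcal S_1(\mathcal H)$ be the space of trace-class operators on $\mathcal H$, $\mathcal S_1^{\mathrm{sa}}(\mathcal H)$ the set of its self-adjoint elements, and $\mathcal S_1^+(\mathcal H)$ the set of its positive (semidefinite) elements. For a positive self-adjoint operator $V$ and $\gamma\in\mathcal S_1^+(\mathcal H)$ put $$\operatorname{Tr}(V\gamma):=\sup_{\varepsilon>0}\operatorname{Tr}(V_\varepsilon\gamma)\in[0,+\infty],\qquad V_\varepsilon:=V(1+\varepsilon V)^{-1}.$$ Define $X^+:=\{\gamma\in\mathcal S_1^+(\mathcal H)\mid \operatorname{Tr}(T\gamma)<+\infty\}$ and $X:=X^+-X^+=\{\gamma^+-\gamma^-\mid\gamma^\pm\in X^+\}$, and define $\|\cdot\|_X:\mathcal S_1(\mathcal H)\to[0,+\infty]$ by $$\|\gamma\|_X:=\inf\bigl\{\operatorname{Tr}((1+T)\gamma^+)+\operatorname{Tr}((1+T)\gamma^-)\;\big|\;\gamma^\pm\in\mathcal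 S_1^+(\mathcal H),\ \gamma=\gamma^+-\gamma^-\bigr\},\qquad \inf\emptyset=+\infty .$$ Then: 1. $\|\cdot\|_X:\mathcal S_1(\mathcal H)\to[0,+\infty]$ is lower semicontinuous with respect to the weak-$*$ topology of $\mathcal S_1(\mathcal H)$, that is, the coarsest topology for which $A\mapsto\operatorname{Tr}(VA)$ is continuous for every compact operator $V$ on $\mathcal H$. In particular, if $\gamma_n,\gamma\in\mathcal S_1(\mathcal H)$ and $\operatorname{Tr}(V(\gamma_n-\gamma))\to0$ for every compact $V$, then $\|\gamma\|_X\le\liminf_{n\to\infty}\|\gamma_n\|_X$. 2. $X\subset\mathcal S_1^{\mathrm{sa}}(\mathcal H)$, and $(X,\|\cdot\|_X)$ is a real Banach space: $X$ is a real linear subspace, $\|\cdot\|_X$ is finite on $X$ and is a norm there, and $X$ is complete with respect to this norm. -/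

import Mathlib

open scoped ENNReal Topology InnerProductSpace
open Filter

noncomputable section

namespace RDM

/-! ### Trace and trace-class operators on a Hilbert space -/

section Trace

variable (H : Type*) [NormedAddCommGroup H] [InnerProductSpace ℂ H] [CompleteSpace H]

/-- The index set of a fixed Hilbert basis (complete orthonormal system) of `H`. -/
def basisIndex : Set H := (exists_hilbertBasis ℂ H).choose

/-- A fixed Hilbert basis of `H`, used to compute traces. -/
def stdBasis : HilbertBasis (basisIndex H) ℂ H := (exists_hilbertBasis ℂ H).choose_spec.choose

variable {H}

/-- The trace `∑ᵢ ⟨eᵢ, A eᵢ⟩ ∈ [0, ∞]` of a positive bounded operator. -/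
def posTrace (A : H →L[ℂ] H) : ℝ≥0∞ :=
  ∑' i, ENNReal.ofReal (RCLike.re ⟪stdBasis H i, A (stdBasis H i)⟫_ℂ)

/-- `A` is trace class: `Tr |A| < ∞`, where `|A| = (A* A)^{1/2}`. -/
def IsTraceClass (A : H →L[ℂ] H) : Prop := posTrace (CFC.abs A) < ∞

/-- The trace `∑ᵢ ⟨eᵢ, A eᵢ⟩ ∈ ℂ` of a trace-class operator. -/
def trace (A : H →L[ℂ] H) : ℂ := ∑' i, ⟪stdBasis H i, A (stdBasis H i)⟫_ℂ

theorem ofReal_norm_sq_eq_tsum {κ : Type*} (d : HilbertBasis κ ℂ H) (x : H) :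
    ENNReal.ofReal (‖x‖ ^ 2) = ∑' j, ENNReal.ofReal (‖⟪d j, x⟫_ℂ‖ ^ 2) := by
  have h : HasSum (fun j => ‖⟪d j, x⟫_ℂ‖ ^ 2) (‖x‖ ^ 2) := by
    have h1 := (d.hasSum_inner_mul_inner x x).mapL (RCLike.reCLM (K := ℂ))
    simp only [RCLike.reCLM_apply] at h1
    rw [inner_self_eq_norm_sq] at h1
    refine h1.congr_fun ?_
    intro j
    rw [← inner_conj_symm x (d j), RCLike.conj_mul]
    norm_cast
  rw [← h.tsum_eq, ENNReal.ofReal_tsum_of_nonneg (fun _ => by positivity) h.summable]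

theorem tsum_norm_sq_eq {ι κ : Type*} (b : HilbertBasis ι ℂ H) (c : HilbertBasis κ ℂ H)
    (S : H →L[ℂ] H) :
    ∑' i, ENNReal.ofReal (‖S (b i)‖ ^ 2)
      = ∑' j, ENNReal.ofReal (‖ContinuousLinearMap.adjoint S (c j)‖ ^ 2) := by
  calc ∑' i, ENNReal.ofReal (‖S (b i)‖ ^ 2)
      = ∑' i, ∑' j, ENNReal.ofReal (‖⟪c j, S (b i)⟫_ℂ‖ ^ 2) :=
        tsum_congr fun i => ofReal_norm_sq_eq_tsum c _
    _ = ∑' j, ∑' i, ENNReal.ofReal (‖⟪c j, S (b i)⟫_ℂ‖ ^ 2) := ENNReal.tsum_comm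
    _ = ∑' j, ∑' i, ENNReal.ofReal
          (‖⟪b i, ContinuousLinearMap.adjoint S (c j)⟫_ℂ‖ ^ 2) := by
        refine tsum_congr fun j => tsum_congr fun i => ?_
        rw [ContinuousLinearMap.adjoint_inner_right, norm_inner_symm]
    _ = _ := tsum_congr fun j => (ofReal_norm_sq_eq_tsum b _).symm

/-- The trace of a positive operator may be computed in every Hilbert basis. -/
theorem posTrace_eq {ι : Type*} (b : HilbertBasis ι ℂ H) {A : H →L[ℂ] H} (hA : 0 ≤ A) :
    posTrace A = ∑' i, ENNReal.ofReal (RCLike.re ⟪b i, A (b i)⟫_ℂ) := by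
  have hS : IsSelfAdjoint (CFC.sqrt A) := (CFC.sqrt_nonneg A).isSelfAdjoint
  have key : ∀ x : H, RCLike.re ⟪x, A x⟫_ℂ = ‖CFC.sqrt A x‖ ^ 2 := by
    intro x
    conv_lhs => rw [← CFC.sqrt_mul_sqrt_self A hA]
    change RCLike.re ⟪x, CFC.sqrt A (CFC.sqrt A x)⟫_ℂ = _
    rw [← ContinuousLinearMap.adjoint_inner_left,
      hS.adjoint_eq, inner_self_eq_norm_sq]
  unfold posTrace
  simp_rw [key]
  rw [tsum_norm_sq_eq _ b, hS.adjoint_eq]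

end Trace

/-- The space `𝓢₁(H)` of trace-class operators. -/
def TraceClass (H : Type*) [NormedAddCommGroup H] [InnerProductSpace ℂ H] [CompleteSpace H] :=
  {A : H →L[ℂ] H // IsTraceClass A}

/-- The operator underlying an element of `𝓢₁(H)`. -/
def TraceClass.op {H : Type*} [NormedAddCommGroup H] [InnerProductSpace ℂ H] [CompleteSpace H]
    (A : TraceClass H) : H →L[ℂ] H := A.1

/-- The weak-* topology of `𝓢₁(H) = 𝓚(H)*`: the coarsest topology making `A ↦ Tr (V A)` continuous
for every compact operator `V`. -/
instance TraceClass.weakStarTopology (H : Type*) [NormedAddCommGroup H] [InnerProductSpace ℂ H]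
    [CompleteSpace H] : TopologicalSpace (TraceClass H) :=
  TopologicalSpace.induced
    (fun (A : TraceClass H) (V : {V : H →L[ℂ] H // IsCompactOperator V}) =>
      trace ((V : H →L[ℂ] H) ∘L A.op))
    Pi.topologicalSpace

/-! ### Positive unbounded operators and `Tr (T γ)` -/

section Unbounded

variable {H : Type*} [NormedAddCommGroup H] [InnerProductSpace ℂ H] [CompleteSpace H]

/-- A possibly unbounded operator is positive if it is self-adjoint (in particular densely defined)
and positive semidefinite. -/
structure IsPositiveOp (T : H →ₗ.[ℂ] H) : Prop where
  selfAdjoint : IsSelfAdjoint T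
  nonneg : ∀ ψ : T.domain, 0 ≤ RCLike.re ⟪(ψ : H), T ψ⟫_ℂ

/-- `B` is the bounded operator `T (1 + ε T)⁻¹`: the operator `1 + ε T` is a bijection from `D(T)`
onto `H`, and `B` maps `ψ + ε T ψ` to `T ψ`. -/
def IsRegularization (T : H →ₗ.[ℂ] H) (ε : ℝ) (B : H →L[ℂ] H) : Prop :=
  Function.Bijective (fun ψ : T.domain => (ψ : H) + (ε : ℂ) • T ψ) ∧
    ∀ ψ : T.domain, B ((ψ : H) + (ε : ℂ) • T ψ) = T ψ

theorem IsRegularization.unique {T : H →ₗ.[ℂ] H} {ε : ℝ} {B C : H →L[ℂ] H}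
    (hB : IsRegularization T ε B) (hC : IsRegularization T ε C) : B = C := by
  ext φ
  obtain ⟨ψ, rfl⟩ := hB.1.2 φ
  exact (hB.2 ψ).trans (hC.2 ψ).symm

open Classical in
/-- The bounded operator `T_ε = T (1 + ε T)⁻¹`. -/
def regularization (T : H →ₗ.[ℂ] H) (ε : ℝ) : H →L[ℂ] H :=
  if h : ∃ B, IsRegularization T ε B then h.choose else 0

theorem sq_bound {T : H →ₗ.[ℂ] H} (hT : IsPositiveOp T) {ε : ℝ} (hε : 0 < ε)
    (ψ : T.domain) :
    ‖(ψ : H)‖ ^ 2 + ε ^ 2 * ‖T ψ‖ ^ 2 ≤ ‖(ψ : H) + (ε : ℂ) • T ψ‖ ^ 2 := by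
  have h := norm_add_sq (𝕜 := ℂ) (ψ : H) ((ε : ℂ) • T ψ)
  rw [inner_smul_right, norm_smul, RCLike.re_to_complex, Complex.re_ofReal_mul,
    Complex.norm_real, Real.norm_eq_abs, mul_pow, sq_abs] at h
  have h2 := mul_nonneg hε.le (hT.nonneg ψ)
  rw [RCLike.re_to_complex] at h2
  linarith

/-- For a positive operator `T` and `ε > 0` the bounded operator `T (1 + ε T)⁻¹` exists. -/
theorem exists_isRegularization {T : H →ₗ.[ℂ] H} (hT : IsPositiveOp T) {ε : ℝ} (hε : 0 < ε) :
    ∃ B, IsRegularization T ε B := by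
  have hdense := hT.selfAdjoint.dense_domain
  have hadj : T.adjoint = T := LinearPMap.isSelfAdjoint_def.mp hT.selfAdjoint
  have hclosed : IsClosed (T.graph : Set (H × H)) := hT.selfAdjoint.isClosed
  have : CompleteSpace T.graph := hclosed.completeSpace_coe
  let F : T.graph →L[ℂ] H :=
    (ContinuousLinearMap.fst ℂ H H + (ε : ℂ) • ContinuousLinearMap.snd ℂ H H) ∘L T.graph.subtypeL
  have hF : ∀ p : T.graph, F p = p.1.1 + (ε : ℂ) • p.1.2 := fun p => rfl
  have hbd : ∀ p : T.graph, ‖p.1.1‖ ≤ ‖F p‖ ∧ ‖p.1.2‖ ≤ ε⁻¹ * ‖F p‖ := by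
    intro p
    obtain ⟨ψ, h1, h2⟩ := LinearPMap.mem_graph_iff _ |>.mp p.2
    have h := sq_bound hT hε ψ
    rw [h1, h2, ← hF] at h
    constructor
    · refine le_of_sq_le_sq ?_ (norm_nonneg _)
      nlinarith [sq_nonneg (ε * ‖p.1.2‖)]
    · rw [inv_mul_eq_div, le_div_iff₀ hε]
      refine le_of_sq_le_sq ?_ (norm_nonneg _)
      nlinarith [sq_nonneg ‖p.1.1‖]
  have hanti : AntilipschitzWith (Real.toNNReal (max 1 ε⁻¹)) F := by
    refine F.antilipschitz_of_bound ?_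
    intro p
    rw [Real.coe_toNNReal _ (le_max_of_le_left zero_le_one)]
    change max ‖p.1.1‖ ‖p.1.2‖ ≤ _
    refine max_le ((hbd p).1.trans ?_) ((hbd p).2.trans ?_)
    · exact le_mul_of_one_le_left (norm_nonneg _) (le_max_left _ _)
    · exact mul_le_mul_of_nonneg_right (le_max_right _ _) (norm_nonneg _)
  have hker : F.ker = ⊥ := LinearMap.ker_eq_bot.mpr hanti.injective
  have hrc : IsClosed (F.range : Set H) := by
    have h := hanti.isClosed_range F.uniformContinuous
    exact h
  have hrange : F.range = ⊤ := by
    have : CompleteSpace F.range := hrc.completeSpace_coe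
    rw [← Submodule.orthogonal_eq_bot_iff, Submodule.eq_bot_iff]
    intro φ hφ
    have horth : ∀ ψ : T.domain, ⟪φ, (ψ : H) + (ε : ℂ) • T ψ⟫_ℂ = 0 := by
      intro ψ
      rw [Submodule.mem_orthogonal'] at hφ
      exact hφ _ ⟨⟨((ψ : H), T ψ), T.mem_graph ψ⟩, rfl⟩
    have hεC : (ε : ℂ) ≠ 0 := by exact_mod_cast hε.ne'
    have hw : ∀ ψ : T.domain, ⟪-((ε : ℂ)⁻¹ • φ), (ψ : H)⟫_ℂ = ⟪φ, T ψ⟫_ℂ := by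
      intro ψ
      have h := horth ψ
      rw [inner_add_right, inner_smul_right] at h
      rw [inner_neg_left, inner_smul_left]
      simp only [map_inv₀, Complex.conj_ofReal]
      field_simp
      linear_combination -h
    have hmem' : φ ∈ T.adjoint.domain := LinearPMap.mem_adjoint_domain_of_exists _ ⟨_, hw⟩
    have hmem : φ ∈ T.domain := by rwa [hadj] at hmem'
    have h0 := sq_bound hT hε ⟨φ, hmem⟩
    have h1 := horth ⟨φ, hmem⟩
    have h2 := hT.nonneg ⟨φ, hmem⟩
    rw [inner_add_right, inner_smul_right] at h1
    have h3 := congrArg Complex.re h1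
    rw [Complex.add_re, Complex.re_ofReal_mul] at h3
    have h4 : (⟪φ, φ⟫_ℂ).re = ‖φ‖ ^ 2 := inner_self_eq_norm_sq (𝕜 := ℂ) φ
    rw [RCLike.re_to_complex] at h2
    simp only [h4, Complex.zero_re] at h3
    have h5 := mul_nonneg hε.le h2
    have h6 : ‖φ‖ ^ 2 ≤ 0 := by linarith
    exact norm_eq_zero.mp (pow_eq_zero_iff two_ne_zero |>.mp (le_antisymm h6 (sq_nonneg _)))
  let e : T.graph ≃L[ℂ] H := ContinuousLinearEquiv.ofBijective F hker hrange
  refine ⟨(ContinuousLinearMap.snd ℂ H H) ∘L T.graph.subtypeL ∘L (e.symm : H →L[ℂ] T.graph),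
    ⟨?_, ?_⟩, ?_⟩
  · intro x y hxy
    have : (⟨((x : H), T x), T.mem_graph x⟩ : T.graph) = ⟨((y : H), T y), T.mem_graph y⟩ :=
      hanti.injective hxy
    exact Subtype.ext (congrArg (fun p : T.graph => p.1.1) this)
  · intro φ
    obtain ⟨p, hp⟩ := e.surjective φ
    obtain ⟨ψ, h1, h2⟩ := LinearPMap.mem_graph_iff _ |>.mp p.2
    refine ⟨ψ, ?_⟩
    change (ψ : H) + (ε : ℂ) • T ψ = φ
    rw [h1, h2, ← hp]
    rfl
  · intro ψ
    have h : e ⟨((ψ : H), T ψ), T.mem_graph ψ⟩ = (ψ : H) + (ε : ℂ) • T ψ := rfl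
    rw [← h]
    simp

theorem isRegularization_regularization {T : H →ₗ.[ℂ] H} (hT : IsPositiveOp T) {ε : ℝ}
    (hε : 0 < ε) : IsRegularization T ε (regularization T ε) := by
  have h := exists_isRegularization hT hε
  rw [regularization, dif_pos h]
  exact h.choose_spec

/-- `Tr (T γ) = sup_{ε > 0} Tr (T_ε γ) ∈ [0, ∞]` for a positive operator `T` and a positive
trace-class operator `γ`. -/
def energyTrace (T : H →ₗ.[ℂ] H) (γ : H →L[ℂ] H) : ℝ≥0∞ :=
  ⨆ (ε : ℝ) (_ : 0 < ε), ENNReal.ofReal (RCLike.re (trace (regularization T ε ∘L γ)))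

/-- The operator `1 + T` with domain `D(T)`. -/
def oneAdd (T : H →ₗ.[ℂ] H) : H →ₗ.[ℂ] H := (LinearMap.id : H →ₗ[ℂ] H) +ᵥ T

/-- `1 + T` is again a positive operator. -/
theorem IsPositiveOp.oneAdd {T : H →ₗ.[ℂ] H} (hT : IsPositiveOp T) : IsPositiveOp (oneAdd T) := by
  have hdense := hT.selfAdjoint.dense_domain
  have hadj : T.adjoint = T := LinearPMap.isSelfAdjoint_def.mp hT.selfAdjoint
  have hformal : T.IsFormalAdjoint T := by
    have h := LinearPMap.adjoint_isFormalAdjoint hdense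
    rwa [hadj] at h
  have hdense' : Dense ((RDM.oneAdd T).domain : Set H) := hdense
  have hf' : (RDM.oneAdd T).IsFormalAdjoint (RDM.oneAdd T) := by
    intro x y
    have h := hformal x y
    change ⟪(x : H) + T x, (y : H)⟫_ℂ = ⟪(x : H), (y : H) + T y⟫_ℂ
    rw [inner_add_left, inner_add_right, h]
  refine ⟨?_, ?_⟩
  · rw [LinearPMap.isSelfAdjoint_def]
    refine (LinearPMap.eq_of_le_of_domain_eq (LinearPMap.IsFormalAdjoint.le_adjoint hdense' hf')
      (le_antisymm (LinearPMap.IsFormalAdjoint.le_adjoint hdense' hf').1 ?_)).symm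
    intro φ hφ
    change φ ∈ T.domain
    suffices φ ∈ T.adjoint.domain by rwa [hadj] at this
    refine LinearPMap.mem_adjoint_domain_of_exists _
      ⟨(RDM.oneAdd T).adjoint ⟨φ, hφ⟩ - φ, fun x => ?_⟩
    have h := LinearPMap.adjoint_isFormalAdjoint hdense' ⟨φ, hφ⟩ x
    change ⟪(RDM.oneAdd T).adjoint ⟨φ, hφ⟩, (x : H)⟫_ℂ = ⟪φ, (x : H) + T x⟫_ℂ at h
    rw [inner_sub_left, h, inner_add_right, add_sub_cancel_left]
  · intro ψ
    change 0 ≤ RCLike.re ⟪(ψ : H), (ψ : H) + T ψ⟫_ℂ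
    rw [inner_add_right, map_add]
    exact add_nonneg inner_self_nonneg (hT.nonneg ψ)

/-! ### The space `X` and the `X`-norm -/

/-- The cone `X⁺` of positive trace-class operators with finite kinetic energy `Tr (T γ)`. -/
def XPos (T : H →ₗ.[ℂ] H) : Set (H →L[ℂ] H) :=
  {γ | γ.IsPositive ∧ IsTraceClass γ ∧ energyTrace T γ < ∞}

/-- `X = X⁺ - X⁺`. -/
def XSpace (T : H →ₗ.[ℂ] H) : Set (H →L[ℂ] H) :=
  {γ | ∃ γp ∈ XPos T, ∃ γm ∈ XPos T, γ = γp - γm}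

/-- The `X`-norm, with values in `[0, ∞]`: the infimum of `Tr ((1+T) γ⁺) + Tr ((1+T) γ⁻)` over all
decompositions `γ = γ⁺ - γ⁻` into positive trace-class operators (`∞` if there is none). -/
def xNorm (T : H →ₗ.[ℂ] H) (γ : H →L[ℂ] H) : ℝ≥0∞ :=
  sInf {t | ∃ γp γm : H →L[ℂ] H, (γp.IsPositive ∧ IsTraceClass γp) ∧
    (γm.IsPositive ∧ IsTraceClass γm) ∧ γ = γp - γm ∧
    t = energyTrace (oneAdd T) γp + energyTrace (oneAdd T) γm}

end Unbounded

/-- The subset `X` of the real vector space `E`, with the extended-real-valued function `N`, is a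
real Banach space: `X` is a real linear subspace, `N` is finite on `X` and restricts to a norm
there, and `X` is complete for this norm. -/
def IsRealBanachSpace {E : Type*} [AddCommGroup E] [Module ℝ E] (X : Set E) (N : E → ℝ≥0∞) :
    Prop :=
  ∃ S : Submodule ℝ E, (S : Set E) = X ∧ (∀ x ∈ X, N x < ∞) ∧
    letI : Norm S := ⟨fun x => (N x).toReal⟩
    ∃ core : NormedSpace.Core ℝ S,
      letI : NormedAddCommGroup S := NormedAddCommGroup.ofCore core
      CompleteSpace S

end RDM

end

/-!
The regularizations `T_ε` are bounded and positive, and the form of `T_ε` is the Moreau–Yosida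
envelope of the form of `T`; comparing envelopes gives `T_ε ≤ (1 + T)_ε ≤ T_ε + 1` and
`1 ≤ (1 + ε) (1 + T)_ε`. For positive `γ` the energy `Tr ((1 + T) γ)` is therefore finite exactly
when `Tr γ` and `Tr (T γ)` are, and it dominates the operator norm of `γ`. As a supremum of sums of
nonnegative functions `γ ↦ ⟨x, γ x⟩`, it is also lower semicontinuous for the weak operator
topology.

Bounded sets of operators are relatively compact in the weak operator topology. The pairs
`(γ⁺, γ⁻)` with total energy at most `C` thus form a compact set, and the sublevel sets of the
`X`-norm are closed, being intersections of images of such sets under subtraction. Testing weak-*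
convergence on rank-one operators yields weak operator convergence, whence the first claim. Since
the `X`-norm dominates the operator norm, a Cauchy sequence in `X` has an operator-norm limit, and
lower semicontinuity makes it the limit in `X`.
-/

noncomputable section

namespace RDM

section Form

variable {H : Type*} [NormedAddCommGroup H] [InnerProductSpace ℂ H]

theorem re_inner_nonneg {A : H →L[ℂ] H} (hA : 0 ≤ A) (x : H) : 0 ≤ RCLike.re ⟪x, A x⟫_ℂ :=
  (A.nonneg_iff_isPositive.mp hA).re_inner_nonneg_right x

theorem re_inner_mono {A B : H →L[ℂ] H} (h : A ≤ B) (x : H) :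
    RCLike.re ⟪x, A x⟫_ℂ ≤ RCLike.re ⟪x, B x⟫_ℂ := by
  simpa [inner_sub_right] using (ContinuousLinearMap.le_def A B).mp h |>.re_inner_nonneg_right x

end Form

section Trace

variable {H : Type*} [NormedAddCommGroup H] [InnerProductSpace ℂ H] [CompleteSpace H]

theorem re_inner_star_mul_self (S : H →L[ℂ] H) (x : H) :
    RCLike.re ⟪x, (star S * S) x⟫_ℂ = ‖S x‖ ^ 2 :=
  (S.apply_norm_sq_eq_inner_adjoint_right x).symm

theorem le_of_forall_re_inner_le {A B : H →L[ℂ] H} (hA : IsSelfAdjoint A) (hB : IsSelfAdjoint B)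
    (h : ∀ x, RCLike.re ⟪x, A x⟫_ℂ ≤ RCLike.re ⟪x, B x⟫_ℂ) : A ≤ B := by
  rw [ContinuousLinearMap.le_def, ContinuousLinearMap.isPositive_def]
  refine ⟨(hB.sub hA).isSymmetric, fun x => ?_⟩
  rw [ContinuousLinearMap.reApplyInnerSelf_apply, inner_re_symm, sub_apply,
    inner_sub_right, map_sub]
  exact sub_nonneg.mpr (h x)

theorem sqrt_mul_self_mul_sqrt_nonneg {A : H →L[ℂ] H} (hA : 0 ≤ A) (B : H →L[ℂ] H) :
    0 ≤ CFC.sqrt B * A * CFC.sqrt B :=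
  (CFC.sqrt_nonneg B).isSelfAdjoint.conjugate_nonneg hA

/-! ### The trace of a positive operator -/

theorem posTrace_mono {A B : H →L[ℂ] H} (h : A ≤ B) : posTrace A ≤ posTrace B :=
  ENNReal.tsum_le_tsum fun _ => ENNReal.ofReal_le_ofReal (re_inner_mono h _)

theorem posTrace_add {A B : H →L[ℂ] H} (hA : 0 ≤ A) (hB : 0 ≤ B) :
    posTrace (A + B) = posTrace A + posTrace B := by
  simp only [posTrace, add_apply, inner_add_right, map_add,
    ENNReal.ofReal_add (re_inner_nonneg hA _) (re_inner_nonneg hB _), ENNReal.tsum_add]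

theorem posTrace_smul {r : ℝ} (hr : 0 ≤ r) (A : H →L[ℂ] H) :
    posTrace (r • A) = ENNReal.ofReal r * posTrace A := by
  simp only [posTrace, smul_apply, inner_smul_right_eq_smul, RCLike.smul_re,
    ENNReal.ofReal_mul hr, ENNReal.tsum_mul_left]

theorem posTrace_star_mul_self (S : H →L[ℂ] H) :
    posTrace (star S * S) = ∑' i, ENNReal.ofReal (‖S (stdBasis H i)‖ ^ 2) := by
  simp only [posTrace, re_inner_star_mul_self]

theorem posTrace_star_mul_self_comm (S : H →L[ℂ] H) :
    posTrace (star S * S) = posTrace (S * star S) := by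
  conv_rhs => rw [← star_star S, star_star (star S), posTrace_star_mul_self]
  rw [posTrace_star_mul_self, tsum_norm_sq_eq _ (stdBasis H)]
  rfl

theorem posTrace_star_mul_mul {A : H →L[ℂ] H} (hA : 0 ≤ A) (C : H →L[ℂ] H) :
    posTrace (star C * A * C) = posTrace (CFC.sqrt A * (C * star C) * CFC.sqrt A) := by
  have hsa : star (CFC.sqrt A) = CFC.sqrt A := (CFC.sqrt_nonneg A).isSelfAdjoint
  have h := posTrace_star_mul_self_comm (CFC.sqrt A * C)
  rw [star_mul, hsa] at h
  simpa only [mul_assoc, ← mul_assoc (CFC.sqrt A) (CFC.sqrt A), CFC.sqrt_mul_sqrt_self A hA]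
    using h

theorem posTrace_star_mul_mul_le {A : H →L[ℂ] H} (hA : 0 ≤ A) (C : H →L[ℂ] H) :
    posTrace (star C * A * C) ≤ ENNReal.ofReal ‖A‖ * posTrace (star C * C) :=
  (posTrace_mono (CStarAlgebra.star_left_conjugate_le_norm_smul hA.isSelfAdjoint)).trans_eq
    (posTrace_smul (norm_nonneg A) _)

theorem posTrace_star_mul_mul_le_of_mul_star_le_one {A C : H →L[ℂ] H} (hA : 0 ≤ A)
    (hC : C * star C ≤ 1) : posTrace (star C * A * C) ≤ posTrace A := by
  have h := (CFC.sqrt_nonneg A).isSelfAdjoint.conjugate_le_conjugate hC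
  rw [mul_one, CFC.sqrt_mul_sqrt_self A hA] at h
  exact (posTrace_star_mul_mul hA C).trans_le (posTrace_mono h)

theorem ofReal_norm_apply_sq_le (S : H →L[ℂ] H) (x : H) :
    ENNReal.ofReal (‖S x‖ ^ 2) ≤ posTrace (star S * S) * ENNReal.ofReal (‖x‖ ^ 2) := by
  rw [posTrace_star_mul_self, tsum_norm_sq_eq _ (stdBasis H), ← ENNReal.tsum_mul_right,
    ofReal_norm_sq_eq_tsum (stdBasis H)]
  refine ENNReal.tsum_le_tsum fun j => ?_
  rw [← ENNReal.ofReal_mul (by positivity), ← mul_pow, ← ContinuousLinearMap.adjoint_inner_left]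
  exact ENNReal.ofReal_le_ofReal (by gcongr; exact norm_inner_le_norm _ _)

theorem ofReal_norm_le_posTrace {A : H →L[ℂ] H} (hA : 0 ≤ A) :
    ENNReal.ofReal ‖A‖ ≤ posTrace A := by
  rcases eq_or_ne (posTrace A) ∞ with htop | htop
  · simp [htop]
  refine (ENNReal.ofReal_le_iff_le_toReal htop).mpr
    ((CStarAlgebra.norm_le_iff_le_algebraMap A ENNReal.toReal_nonneg hA).mpr ?_)
  refine le_of_forall_re_inner_le hA.isSelfAdjoint (.algebraMap _ (.all _)) fun x => ?_
  have hroot : star (CFC.sqrt A) * CFC.sqrt A = A := by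
    rw [(CFC.sqrt_nonneg A).star_eq, CFC.sqrt_mul_sqrt_self A hA]
  have h := ENNReal.toReal_mono (ENNReal.mul_ne_top (by rwa [hroot]) ENNReal.ofReal_ne_top)
    (ofReal_norm_apply_sq_le (CFC.sqrt A) x)
  rw [ENNReal.toReal_mul, ENNReal.toReal_ofReal (by positivity),
    ENNReal.toReal_ofReal (by positivity), ← re_inner_star_mul_self, hroot] at h
  rw [Algebra.algebraMap_eq_smul_one, smul_apply,
    one_apply_eq_self, inner_smul_right_eq_smul, RCLike.smul_re,
    inner_self_eq_norm_sq]
  exact h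

theorem isTraceClass_iff_of_nonneg {A : H →L[ℂ] H} (hA : 0 ≤ A) :
    IsTraceClass A ↔ posTrace A < ∞ := by
  rw [IsTraceClass, CFC.abs_of_nonneg A hA]

theorem exists_isStarProjection_conj_eq_posPart {A : H →L[ℂ] H} (hA : IsSelfAdjoint A) :
    ∃ Q : H →L[ℂ] H, IsStarProjection Q ∧ star Q * A * Q = A⁺ := by
  let K : Submodule ℂ H := (A⁻).ker
  have : CompleteSpace K := (A⁻).isClosed_ker.completeSpace_coe
  let Q : H →L[ℂ] H := K.starProjection
  have hQ : IsStarProjection Q := isStarProjection_starProjection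
  have hQ_posPart : Q * A⁺ = A⁺ := by
    ext x
    exact Submodule.starProjection_eq_self_iff.mpr
      (DFunLike.congr_fun (CFC.negPart_mul_posPart A) x)
  have hposPart_Q : A⁺ * Q = A⁺ := by
    have h := congrArg star hQ_posPart
    rwa [star_mul, hQ.isSelfAdjoint.star_eq, (CFC.posPart_nonneg A).isSelfAdjoint.star_eq] at h
  have hnegPart_Q : A⁻ * Q = 0 := by
    ext x
    exact K.starProjection_apply_mem x
  refine ⟨Q, hQ, ?_⟩
  calc star Q * A * Q = Q * (A⁺ - A⁻) * Q := by
        rw [hQ.isSelfAdjoint.star_eq, CFC.posPart_sub_negPart A]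
    _ = A⁺ := by rw [mul_assoc, sub_mul, hposPart_Q, hnegPart_Q, sub_zero, hQ_posPart]

theorem posTrace_posPart_sub_le {P M : H →L[ℂ] H} (hP : 0 ≤ P) (hM : 0 ≤ M) :
    posTrace (P - M)⁺ ≤ posTrace P := by
  obtain ⟨Q, hQ, hconj⟩ :=
    exists_isStarProjection_conj_eq_posPart (hP.isSelfAdjoint.sub hM.isSelfAdjoint)
  have hQ_le : Q * star Q ≤ 1 := by
    rw [hQ.isSelfAdjoint.star_eq, hQ.isIdempotentElem.eq]
    exact hQ.le_one
  calc posTrace (P - M)⁺ = posTrace (star Q * (P - M) * Q) := by rw [hconj]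
    _ ≤ posTrace (star Q * P * Q) :=
      posTrace_mono (star_left_conjugate_le_conjugate (sub_le_self P hM) Q)
    _ ≤ posTrace P := posTrace_star_mul_mul_le_of_mul_star_le_one hP hQ_le

theorem posTrace_abs {A : H →L[ℂ] H} (hA : IsSelfAdjoint A) :
    posTrace (CFC.abs A) = posTrace A⁺ + posTrace A⁻ := by
  rw [← CFC.posPart_add_negPart A hA]
  exact posTrace_add (CFC.posPart_nonneg A) (CFC.negPart_nonneg A)

theorem posTrace_abs_sub_le {P M : H →L[ℂ] H} (hP : 0 ≤ P) (hM : 0 ≤ M) :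
    posTrace (CFC.abs (P - M)) ≤ posTrace P + posTrace M := by
  have hneg : (P - M)⁻ = (M - P)⁺ := by rw [← CFC.posPart_neg, neg_sub]
  rw [posTrace_abs (hP.isSelfAdjoint.sub hM.isSelfAdjoint), hneg]
  exact add_le_add (posTrace_posPart_sub_le hP hM) (posTrace_posPart_sub_le hM hP)

theorem isTraceClass_sub_of_nonneg {P M : H →L[ℂ] H} (hP : 0 ≤ P) (hM : 0 ≤ M)
    (hP' : IsTraceClass P) (hM' : IsTraceClass M) : IsTraceClass (P - M) := by
  rw [isTraceClass_iff_of_nonneg hP] at hP'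
  rw [isTraceClass_iff_of_nonneg hM] at hM'
  exact (posTrace_abs_sub_le hP hM).trans_lt (ENNReal.add_lt_top.mpr ⟨hP', hM'⟩)

/-! ### Cyclicity of the trace -/

theorem summable_norm_inner_sq {S : H →L[ℂ] H} (hS : posTrace (star S * S) < ∞) :
    Summable fun p : basisIndex H × basisIndex H =>
      ‖⟪stdBasis H p.2, S (stdBasis H p.1)⟫_ℂ‖ ^ 2 := by
  have h : ∑' p : basisIndex H × basisIndex H,
      ENNReal.ofReal (‖⟪stdBasis H p.2, S (stdBasis H p.1)⟫_ℂ‖ ^ 2) ≠ ∞ := by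
    simp_rw [ENNReal.tsum_prod', ← ofReal_norm_sq_eq_tsum, ← posTrace_star_mul_self]
    exact hS.ne
  refine (ENNReal.summable_toReal h).congr fun p => ?_
  rw [ENNReal.toReal_ofReal (by positivity)]

theorem inner_star_apply (P : H →L[ℂ] H) (x y : H) : ⟪x, star P y⟫_ℂ = ⟪P x, y⟫_ℂ :=
  ContinuousLinearMap.adjoint_inner_right P x y

theorem summable_inner_mul_inner {P Q : H →L[ℂ] H} (hP : posTrace (star P * P) < ∞)
    (hQ : posTrace (star Q * Q) < ∞) :
    Summable fun p : basisIndex H × basisIndex H =>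
      ⟪P (stdBasis H p.1), stdBasis H p.2⟫_ℂ * ⟪stdBasis H p.2, Q (stdBasis H p.1)⟫_ℂ := by
  refine .of_norm_bounded
    ((summable_norm_inner_sq hP).add (summable_norm_inner_sq hQ)) fun p => ?_
  rw [norm_mul, norm_inner_symm]
  refine le_trans ?_ (two_mul_le_add_sq _ _)
  exact mul_le_mul_of_nonneg_right (le_mul_of_one_le_left (norm_nonneg _) one_le_two)
    (norm_nonneg _)

theorem trace_star_mul_eq_tsum (P Q : H →L[ℂ] H) :
    trace (star P * Q) =
      ∑' i, ∑' j, ⟪P (stdBasis H i), stdBasis H j⟫_ℂ * ⟪stdBasis H j, Q (stdBasis H i)⟫_ℂ := by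
  simp only [trace, mul_apply_eq_comp, inner_star_apply, HilbertBasis.tsum_inner_mul_inner]

theorem trace_star_mul_comm {P Q : H →L[ℂ] H} (hP : posTrace (star P * P) < ∞)
    (hQ : posTrace (star Q * Q) < ∞) : trace (star P * Q) = trace (Q * star P) := by
  have hsum := summable_inner_mul_inner hP hQ
  calc trace (star P * Q)
      = ∑' i, ∑' j, ⟪P (stdBasis H i), stdBasis H j⟫_ℂ * ⟪stdBasis H j, Q (stdBasis H i)⟫_ℂ :=
        trace_star_mul_eq_tsum P Q
    _ = ∑' j, ∑' i, ⟪P (stdBasis H i), stdBasis H j⟫_ℂ * ⟪stdBasis H j, Q (stdBasis H i)⟫_ℂ :=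
        (Summable.tsum_comm hsum).symm
    _ = ∑' j, ∑' i, ⟪star Q (stdBasis H j), stdBasis H i⟫_ℂ *
          ⟪stdBasis H i, star P (stdBasis H j)⟫_ℂ := by
        refine tsum_congr fun j => tsum_congr fun i => ?_
        rw [inner_star_apply, mul_comm, ← inner_star_apply (star Q), star_star]
    _ = trace (Q * star P) := by
        rw [← trace_star_mul_eq_tsum, star_star]

theorem ofReal_re_trace {A : H →L[ℂ] H} (hA : 0 ≤ A) (hA' : posTrace A < ∞) :
    ENNReal.ofReal (RCLike.re (trace A)) = posTrace A := by
  have hinner : ∀ i, ⟪stdBasis H i, A (stdBasis H i)⟫_ℂ =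
      (RCLike.re ⟪stdBasis H i, A (stdBasis H i)⟫_ℂ : ℂ) := fun i =>
    (((ContinuousLinearMap.nonneg_iff_isPositive A).mp hA).isSymmetric
      |>.coe_re_inner_self_apply _).symm
  have hsum : Summable fun i => RCLike.re ⟪stdBasis H i, A (stdBasis H i)⟫_ℂ := by
    refine (ENNReal.summable_toReal hA'.ne).congr fun i => ?_
    rw [ENNReal.toReal_ofReal (re_inner_nonneg hA _)]
  rw [trace, tsum_congr hinner, ← Complex.ofReal_tsum, posTrace,
    ← ENNReal.ofReal_tsum_of_nonneg (fun i => re_inner_nonneg hA _) hsum]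
  rfl

/-! ### The trace of a product of positive operators -/

/-- The trace `Tr (B γ) ∈ [0, ∞]` of a product of positive bounded operators, read as the trace of
the positive operator `B^{1/2} γ B^{1/2}` so that it makes sense when `B γ` is not trace class. -/
def posTraceMul (B γ : H →L[ℂ] H) : ℝ≥0∞ :=
  posTrace (CFC.sqrt B * γ * CFC.sqrt B)

theorem posTraceMul_comm {B γ : H →L[ℂ] H} (hB : 0 ≤ B) (hγ : 0 ≤ γ) :
    posTraceMul B γ = posTraceMul γ B := by
  have h := posTrace_star_mul_mul hγ (CFC.sqrt B)
  rwa [(CFC.sqrt_nonneg B).isSelfAdjoint.star_eq, CFC.sqrt_mul_sqrt_self B hB] at h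

theorem posTraceMul_le {B γ : H →L[ℂ] H} (hB : 0 ≤ B) (hγ : 0 ≤ γ) :
    posTraceMul B γ ≤ ENNReal.ofReal ‖B‖ * posTrace γ := by
  have h := posTrace_star_mul_mul_le hB (CFC.sqrt γ)
  rw [(CFC.sqrt_nonneg γ).isSelfAdjoint.star_eq, CFC.sqrt_mul_sqrt_self γ hγ] at h
  exact (posTraceMul_comm hB hγ).trans_le h

theorem ofReal_re_trace_mul {B γ : H →L[ℂ] H} (hB : 0 ≤ B) (hγ : 0 ≤ γ) (hγ' : posTrace γ < ∞) :
    ENNReal.ofReal (RCLike.re (trace (B * γ))) = posTraceMul B γ := by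
  have hroot : star (CFC.sqrt γ) = CFC.sqrt γ := (CFC.sqrt_nonneg γ).isSelfAdjoint
  have hroot_sq : CFC.sqrt γ * CFC.sqrt γ = γ := CFC.sqrt_mul_sqrt_self γ hγ
  have lt_top (C : H →L[ℂ] H) (hC : 0 ≤ C) : posTraceMul γ C < ∞ :=
    (posTraceMul_comm hC hγ).symm.trans_lt
      ((posTraceMul_le hC hγ).trans_lt (ENNReal.mul_lt_top ENNReal.ofReal_lt_top hγ'))
  have hHS : posTrace (star (CFC.sqrt γ * B) * (CFC.sqrt γ * B)) < ∞ := by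
    rw [star_mul, hroot, mul_assoc, ← mul_assoc (CFC.sqrt γ), hroot_sq, ← mul_assoc,
      posTrace_star_mul_mul hγ]
    exact lt_top _ (mul_star_self_nonneg B)
  have hcyc : trace (B * γ) = trace (CFC.sqrt γ * B * CFC.sqrt γ) := by
    have h := trace_star_mul_comm hHS (Q := CFC.sqrt γ) (by rwa [hroot, hroot_sq])
    rw [star_mul, hroot, hB.isSelfAdjoint.star_eq, mul_assoc, hroot_sq] at h
    rw [h, mul_assoc]
  rw [hcyc, posTraceMul_comm hB hγ]
  exact ofReal_re_trace (sqrt_mul_self_mul_sqrt_nonneg hB γ) (lt_top B hB)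

theorem posTraceMul_mono_left {B C γ : H →L[ℂ] H} (hB : 0 ≤ B) (hBC : B ≤ C) (hγ : 0 ≤ γ) :
    posTraceMul B γ ≤ posTraceMul C γ := by
  rw [posTraceMul_comm hB hγ, posTraceMul_comm (hB.trans hBC) hγ]
  exact posTrace_mono ((CFC.sqrt_nonneg γ).isSelfAdjoint.conjugate_le_conjugate hBC)

theorem posTraceMul_add_right {γ δ : H →L[ℂ] H} (B : H →L[ℂ] H) (hγ : 0 ≤ γ) (hδ : 0 ≤ δ) :
    posTraceMul B (γ + δ) = posTraceMul B γ + posTraceMul B δ := by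
  rw [posTraceMul, mul_add, add_mul]
  exact posTrace_add (sqrt_mul_self_mul_sqrt_nonneg hγ B) (sqrt_mul_self_mul_sqrt_nonneg hδ B)

theorem posTraceMul_add_left {B C γ : H →L[ℂ] H} (hB : 0 ≤ B) (hC : 0 ≤ C) (hγ : 0 ≤ γ) :
    posTraceMul (B + C) γ = posTraceMul B γ + posTraceMul C γ := by
  rw [posTraceMul_comm (add_nonneg hB hC) hγ, posTraceMul_comm hB hγ, posTraceMul_comm hC hγ,
    posTraceMul_add_right γ hB hC]

theorem posTraceMul_smul_right {r : ℝ} (hr : 0 ≤ r) (B γ : H →L[ℂ] H) :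
    posTraceMul B (r • γ) = ENNReal.ofReal r * posTraceMul B γ := by
  rw [posTraceMul, mul_smul_comm, smul_mul_assoc, posTrace_smul hr, posTraceMul]

theorem posTraceMul_one_left (γ : H →L[ℂ] H) : posTraceMul 1 γ = posTrace γ := by
  rw [posTraceMul, CFC.sqrt_one, one_mul, mul_one]

end Trace

/-! ### The quadratic forms of the regularizations -/

section UnboundedForm

variable {H : Type*} [NormedAddCommGroup H] [InnerProductSpace ℂ H]

theorem re_inner_add_smul_apply (T : H →ₗ.[ℂ] H) (ε : ℝ) (ψ : T.domain) :
    RCLike.re ⟪(ψ : H) + (ε : ℂ) • T ψ, T ψ⟫_ℂ =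
      RCLike.re ⟪(ψ : H), T ψ⟫_ℂ + ε * ‖T ψ‖ ^ 2 := by
  rw [inner_add_left, inner_smul_left, Complex.conj_ofReal, inner_self_eq_norm_sq_to_K, map_add]
  simp only [RCLike.re_to_complex, Complex.re_ofReal_mul]
  norm_cast

theorem re_inner_oneAdd (T : H →ₗ.[ℂ] H) (ψ : T.domain) :
    RCLike.re ⟪(ψ : H), oneAdd T ψ⟫_ℂ = ‖(ψ : H)‖ ^ 2 + RCLike.re ⟪(ψ : H), T ψ⟫_ℂ := by
  change RCLike.re ⟪(ψ : H), (ψ : H) + T ψ⟫_ℂ = _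
  rw [inner_add_right, map_add, inner_self_eq_norm_sq]

end UnboundedForm

section Unbounded

variable {H : Type*} [NormedAddCommGroup H] [InnerProductSpace ℂ H] [CompleteSpace H]
variable {T : H →ₗ.[ℂ] H} {ε : ℝ}

theorem IsPositiveOp.isFormalAdjoint (hT : IsPositiveOp T) : T.IsFormalAdjoint T := by
  have h := LinearPMap.adjoint_isFormalAdjoint hT.selfAdjoint.dense_domain
  rwa [LinearPMap.isSelfAdjoint_def.mp hT.selfAdjoint] at h

theorem exists_regularization_eq (hT : IsPositiveOp T) (hε : 0 < ε) (φ : H) :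
    ∃ ψ : T.domain, (ψ : H) + (ε : ℂ) • T ψ = φ ∧ regularization T ε φ = T ψ := by
  have h := isRegularization_regularization hT hε
  obtain ⟨ψ, rfl⟩ := h.1.2 φ
  exact ⟨ψ, rfl, h.2 ψ⟩

theorem regularization_nonneg (hT : IsPositiveOp T) (hε : 0 < ε) : 0 ≤ regularization T ε := by
  rw [ContinuousLinearMap.nonneg_iff_isPositive, ContinuousLinearMap.isPositive_def]
  refine ⟨fun x y => ?_, fun x => ?_⟩
  · obtain ⟨ψ, rfl, hψ⟩ := exists_regularization_eq hT hε x
    obtain ⟨χ, rfl, hχ⟩ := exists_regularization_eq hT hε y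
    rw [ContinuousLinearMap.coe_coe, hψ, hχ, inner_add_left, inner_add_right, inner_smul_left,
      inner_smul_right, Complex.conj_ofReal, hT.isFormalAdjoint ψ χ]
  · obtain ⟨ψ, rfl, hψ⟩ := exists_regularization_eq hT hε x
    rw [ContinuousLinearMap.reApplyInnerSelf_apply, hψ, inner_re_symm, re_inner_add_smul_apply]
    have := hT.nonneg ψ
    positivity

theorem exists_re_inner_regularization_eq (hT : IsPositiveOp T) (hε : 0 < ε) (φ : H) :
    ∃ ψ : T.domain, ‖(ψ : H)‖ ≤ ‖φ‖ ∧ RCLike.re ⟪φ, regularization T ε φ⟫_ℂ =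
      RCLike.re ⟪(ψ : H), T ψ⟫_ℂ + ε⁻¹ * ‖φ - ψ‖ ^ 2 := by
  obtain ⟨ψ, rfl, hψ⟩ := exists_regularization_eq hT hε φ
  refine ⟨ψ, ?_, ?_⟩
  · refine le_of_sq_le_sq ((le_add_of_nonneg_right ?_).trans (sq_bound hT hε ψ)) (norm_nonneg _)
    positivity
  · rw [hψ, re_inner_add_smul_apply, add_sub_cancel_left, norm_smul, Complex.norm_real,
      Real.norm_of_nonneg hε.le]
    field_simp

/-- The form of `T (1 + ε T)⁻¹` is the Moreau–Yosida envelope of the form of `T`: the gap between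
the two sides at `ψ = χ + h`, where `φ = χ + ε T χ`, is `⟨h, T h⟩ + ε⁻¹ ‖h‖²`. -/
theorem re_inner_regularization_le (hT : IsPositiveOp T) (hε : 0 < ε) (φ : H) (ψ : T.domain) :
    RCLike.re ⟪φ, regularization T ε φ⟫_ℂ ≤
      RCLike.re ⟪(ψ : H), T ψ⟫_ℂ + ε⁻¹ * ‖φ - ψ‖ ^ 2 := by
  obtain ⟨χ, rfl, hχ⟩ := exists_regularization_eq hT hε φ
  obtain ⟨h, rfl⟩ : ∃ h, ψ = χ + h := ⟨ψ - χ, by abel⟩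
  have hnonneg : 0 ≤ RCLike.re ⟪(h : H), T h⟫_ℂ + ε⁻¹ * ‖(h : H)‖ ^ 2 :=
    add_nonneg (hT.nonneg h) (by positivity)
  have hcross : RCLike.re ⟪(χ : H), T h⟫_ℂ = RCLike.re ⟪(h : H), T χ⟫_ℂ := by
    rw [← hT.isFormalAdjoint χ h, inner_re_symm]
  have hform : RCLike.re ⟪((χ + h : T.domain) : H), T (χ + h)⟫_ℂ =
      RCLike.re ⟪(χ : H), T χ⟫_ℂ + 2 * RCLike.re ⟪(h : H), T χ⟫_ℂ +
        RCLike.re ⟪(h : H), T h⟫_ℂ := by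
    rw [T.map_add, Submodule.coe_add, inner_add_left, inner_add_right, inner_add_right]
    simp only [map_add, hcross]
    ring
  have hnorm : ε⁻¹ * ‖(χ : H) + (ε : ℂ) • T χ - ((χ + h : T.domain) : H)‖ ^ 2 =
      ε * ‖T χ‖ ^ 2 - 2 * RCLike.re ⟪(h : H), T χ⟫_ℂ + ε⁻¹ * ‖(h : H)‖ ^ 2 := by
    rw [Submodule.coe_add, add_sub_add_left_eq_sub, norm_sub_sq (𝕜 := ℂ), inner_re_symm,
      inner_smul_right, norm_smul, Complex.norm_real, Real.norm_of_nonneg hε.le,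
      RCLike.re_to_complex, Complex.re_ofReal_mul, RCLike.re_to_complex]
    field_simp
  rw [hχ, re_inner_add_smul_apply, hform, hnorm]
  linarith

theorem regularization_le_regularization_oneAdd (hT : IsPositiveOp T) (hε : 0 < ε) :
    regularization T ε ≤ regularization (oneAdd T) ε := by
  refine le_of_forall_re_inner_le (regularization_nonneg hT hε).isSelfAdjoint
    (regularization_nonneg hT.oneAdd hε).isSelfAdjoint fun φ => ?_
  obtain ⟨ψ, -, hψ⟩ := exists_re_inner_regularization_eq hT.oneAdd hε φ
  have h := re_inner_regularization_le hT hε φ ψ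
  have hform : RCLike.re ⟪(ψ : H), oneAdd T ψ⟫_ℂ = _ := re_inner_oneAdd T ψ
  rw [hψ, hform]
  linarith [sq_nonneg ‖(ψ : H)‖]

theorem regularization_oneAdd_le (hT : IsPositiveOp T) (hε : 0 < ε) :
    regularization (oneAdd T) ε ≤ regularization T ε + 1 := by
  refine le_of_forall_re_inner_le (regularization_nonneg hT.oneAdd hε).isSelfAdjoint
    ((regularization_nonneg hT hε).isSelfAdjoint.add (.one _)) fun φ => ?_
  obtain ⟨ψ, hψφ, hψ⟩ := exists_re_inner_regularization_eq hT hε φ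
  have h := re_inner_regularization_le hT.oneAdd hε φ ψ
  have hsq : ‖(ψ : H)‖ ^ 2 ≤ ‖φ‖ ^ 2 := by gcongr
  rw [re_inner_oneAdd] at h
  rw [add_apply, inner_add_right, map_add, hψ, one_apply_eq_self, inner_self_eq_norm_sq]
  linarith

theorem one_le_smul_regularization_oneAdd (hT : IsPositiveOp T) (hε : 0 < ε) :
    1 ≤ (1 + ε) • regularization (oneAdd T) ε := by
  have hpos : 0 ≤ (1 + ε) • regularization (oneAdd T) ε :=
    smul_nonneg (by positivity) (regularization_nonneg hT.oneAdd hε)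
  refine le_of_forall_re_inner_le (.one _) hpos.isSelfAdjoint fun φ => ?_
  obtain ⟨ψ, -, hψ⟩ := exists_re_inner_regularization_eq hT.oneAdd hε φ
  have hform : RCLike.re ⟪(ψ : H), oneAdd T ψ⟫_ℂ = _ := re_inner_oneAdd T ψ
  have htriangle : ‖φ‖ ≤ ‖(ψ : H)‖ + ‖φ - ψ‖ := norm_le_norm_add_norm_sub' φ (ψ : H)
  have hyoung : (‖(ψ : H)‖ + ‖φ - ψ‖) ^ 2 ≤ (1 + ε) * (‖(ψ : H)‖ ^ 2 + ε⁻¹ * ‖φ - ψ‖ ^ 2) := by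
    have hgap : (1 + ε) * (‖(ψ : H)‖ ^ 2 + ε⁻¹ * ‖φ - ψ‖ ^ 2) - (‖(ψ : H)‖ + ‖φ - ψ‖) ^ 2 =
        ε⁻¹ * (ε * ‖(ψ : H)‖ - ‖φ - ψ‖) ^ 2 := by
      field_simp
      ring
    exact sub_nonneg.mp (hgap ▸ by positivity)
  rw [one_apply_eq_self, inner_self_eq_norm_sq, smul_apply, inner_smul_right_eq_smul,
    RCLike.smul_re, hψ, hform]
  calc ‖φ‖ ^ 2 ≤ (‖(ψ : H)‖ + ‖φ - ψ‖) ^ 2 := by gcongr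
    _ ≤ (1 + ε) * (‖(ψ : H)‖ ^ 2 + ε⁻¹ * ‖φ - ψ‖ ^ 2) := hyoung
    _ ≤ _ := by
      gcongr
      exact le_add_of_nonneg_right (hT.nonneg ψ)

end Unbounded

section Energy

variable {H : Type*} [NormedAddCommGroup H] [InnerProductSpace ℂ H] [CompleteSpace H]
variable {T : H →ₗ.[ℂ] H} {γ δ P M : H →L[ℂ] H}

/-! ### The energy of a positive operator -/

/-- The energy `Tr (T γ) ∈ [0, ∞]` of a positive bounded operator `γ`. It agrees with
`energyTrace T γ` when `γ` is trace class, and is additionally meaningful (rather than a junk value)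
when `γ` is not. -/
def formEnergy (T : H →ₗ.[ℂ] H) (γ : H →L[ℂ] H) : ℝ≥0∞ :=
  ⨆ (ε : ℝ) (_ : 0 < ε), posTraceMul (regularization T ε) γ

theorem posTraceMul_regularization_le_formEnergy (T : H →ₗ.[ℂ] H) {ε : ℝ} (hε : 0 < ε)
    (γ : H →L[ℂ] H) : posTraceMul (regularization T ε) γ ≤ formEnergy T γ :=
  le_iSup₂ (f := fun (ε : ℝ) (_ : 0 < ε) => posTraceMul (regularization T ε) γ) ε hε

theorem energyTrace_eq_formEnergy (hT : IsPositiveOp T) (hγ : 0 ≤ γ) (hγ' : posTrace γ < ∞) :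
    energyTrace T γ = formEnergy T γ :=
  biSup_congr fun _ hε => ofReal_re_trace_mul (regularization_nonneg hT hε) hγ hγ'

theorem formEnergy_le_formEnergy_oneAdd (hT : IsPositiveOp T) (hγ : 0 ≤ γ) :
    formEnergy T γ ≤ formEnergy (oneAdd T) γ :=
  iSup₂_mono fun _ hε => posTraceMul_mono_left (regularization_nonneg hT hε)
    (regularization_le_regularization_oneAdd hT hε) hγ

theorem formEnergy_oneAdd_le (hT : IsPositiveOp T) (hγ : 0 ≤ γ) :
    formEnergy (oneAdd T) γ ≤ formEnergy T γ + posTrace γ := by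
  refine iSup₂_le fun ε hε => ?_
  calc posTraceMul (regularization (oneAdd T) ε) γ
      ≤ posTraceMul (regularization T ε + 1) γ :=
        posTraceMul_mono_left (regularization_nonneg hT.oneAdd hε) (regularization_oneAdd_le hT hε)
          hγ
    _ = posTraceMul (regularization T ε) γ + posTrace γ := by
        rw [posTraceMul_add_left (regularization_nonneg hT hε) zero_le_one hγ,
          posTraceMul_one_left]
    _ ≤ formEnergy T γ + posTrace γ := by
        gcongr
        exact posTraceMul_regularization_le_formEnergy T hε γ

theorem posTrace_le_formEnergy_oneAdd (hT : IsPositiveOp T) (hγ : 0 ≤ γ) :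
    posTrace γ ≤ formEnergy (oneAdd T) γ := by
  have hle : ∀ ε > 0, posTrace γ ≤ ENNReal.ofReal (1 + ε) * formEnergy (oneAdd T) γ := by
    intro ε hε
    have hR := regularization_nonneg hT.oneAdd hε
    have hone : 0 ≤ 1 + ε := by positivity
    calc posTrace γ = posTraceMul 1 γ := (posTraceMul_one_left γ).symm
      _ ≤ posTraceMul ((1 + ε) • regularization (oneAdd T) ε) γ :=
        posTraceMul_mono_left zero_le_one (one_le_smul_regularization_oneAdd hT hε) hγ
      _ = ENNReal.ofReal (1 + ε) * posTraceMul (regularization (oneAdd T) ε) γ := by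
        rw [posTraceMul_comm (smul_nonneg hone hR) hγ, posTraceMul_smul_right hone,
          posTraceMul_comm hR hγ]
      _ ≤ ENNReal.ofReal (1 + ε) * formEnergy (oneAdd T) γ := by
        gcongr
        exact posTraceMul_regularization_le_formEnergy _ hε γ
  have hlim : Tendsto (fun ε : ℝ => ENNReal.ofReal (1 + ε)) (𝓝[>] 0) (𝓝 1) := by
    have h : Continuous fun ε : ℝ => ENNReal.ofReal (1 + ε) :=
      ENNReal.continuous_ofReal.comp (continuous_const_add 1)
    simpa using (h.tendsto 0).mono_left nhdsWithin_le_nhds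
  have hmul := ENNReal.Tendsto.mul_const (b := formEnergy (oneAdd T) γ) hlim (.inl one_ne_zero)
  rw [one_mul] at hmul
  exact ge_of_tendsto hmul (eventually_mem_nhdsWithin.mono hle)

theorem formEnergy_add_le (T : H →ₗ.[ℂ] H) (hγ : 0 ≤ γ) (hδ : 0 ≤ δ) :
    formEnergy T (γ + δ) ≤ formEnergy T γ + formEnergy T δ := by
  refine iSup₂_le fun ε hε => ?_
  rw [posTraceMul_add_right _ hγ hδ]
  exact add_le_add (posTraceMul_regularization_le_formEnergy T hε γ)
    (posTraceMul_regularization_le_formEnergy T hε δ)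

theorem formEnergy_smul (T : H →ₗ.[ℂ] H) {r : ℝ} (hr : 0 ≤ r) (γ : H →L[ℂ] H) :
    formEnergy T (r • γ) = ENNReal.ofReal r * formEnergy T γ := by
  simp only [formEnergy, posTraceMul_smul_right hr, ENNReal.mul_iSup]

theorem isTraceClass_of_formEnergy_oneAdd_lt_top (hT : IsPositiveOp T) (hγ : 0 ≤ γ)
    (h : formEnergy (oneAdd T) γ < ∞) : IsTraceClass γ :=
  (isTraceClass_iff_of_nonneg hγ).mpr ((posTrace_le_formEnergy_oneAdd hT hγ).trans_lt h)

theorem mem_XPos_iff (hT : IsPositiveOp T) :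
    γ ∈ XPos T ↔ 0 ≤ γ ∧ formEnergy (oneAdd T) γ < ∞ := by
  rw [XPos, Set.mem_ofPred_eq, ← ContinuousLinearMap.nonneg_iff_isPositive]
  constructor
  · rintro ⟨hγ, htr, hE⟩
    rw [isTraceClass_iff_of_nonneg hγ] at htr
    rw [energyTrace_eq_formEnergy hT hγ htr] at hE
    exact ⟨hγ, (formEnergy_oneAdd_le hT hγ).trans_lt (ENNReal.add_lt_top.mpr ⟨hE, htr⟩)⟩
  · rintro ⟨hγ, hE⟩
    have htr := isTraceClass_of_formEnergy_oneAdd_lt_top hT hγ hE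
    refine ⟨hγ, htr, ?_⟩
    rw [energyTrace_eq_formEnergy hT hγ ((isTraceClass_iff_of_nonneg hγ).mp htr)]
    exact (formEnergy_le_formEnergy_oneAdd hT hγ).trans_lt hE

/-! ### The `X`-norm -/

theorem xNorm_lt_iff (hT : IsPositiveOp T) {C : ℝ≥0∞} :
    xNorm T γ < C ↔ ∃ P M : H →L[ℂ] H, 0 ≤ P ∧ 0 ≤ M ∧ γ = P - M ∧
      formEnergy (oneAdd T) P + formEnergy (oneAdd T) M < C := by
  have henergy {A : H →L[ℂ] H} (hA : 0 ≤ A) (htr : IsTraceClass A) :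
      energyTrace (oneAdd T) A = formEnergy (oneAdd T) A :=
    energyTrace_eq_formEnergy hT.oneAdd hA ((isTraceClass_iff_of_nonneg hA).mp htr)
  simp only [xNorm, sInf_lt_iff, Set.mem_ofPred_eq, ← ContinuousLinearMap.nonneg_iff_isPositive]
  constructor
  · rintro ⟨_, ⟨P, M, ⟨hP, hP'⟩, ⟨hM, hM'⟩, hγ, rfl⟩, hlt⟩
    rw [henergy hP hP', henergy hM hM'] at hlt
    exact ⟨P, M, hP, hM, hγ, hlt⟩
  · rintro ⟨P, M, hP, hM, hγ, hlt⟩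
    obtain ⟨hEP, hEM⟩ := ENNReal.add_lt_top.mp (hlt.trans_le le_top)
    have hP' := isTraceClass_of_formEnergy_oneAdd_lt_top hT hP hEP
    have hM' := isTraceClass_of_formEnergy_oneAdd_lt_top hT hM hEM
    rw [← henergy hP hP', ← henergy hM hM'] at hlt
    exact ⟨_, ⟨P, M, ⟨hP, hP'⟩, ⟨hM, hM'⟩, hγ, rfl⟩, hlt⟩

theorem xNorm_sub_le (hT : IsPositiveOp T) (hP : 0 ≤ P) (hM : 0 ≤ M) :
    xNorm T (P - M) ≤ formEnergy (oneAdd T) P + formEnergy (oneAdd T) M :=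
  le_of_forall_gt fun _ hC => (xNorm_lt_iff hT).mpr ⟨P, M, hP, hM, rfl, hC⟩

theorem le_xNorm_iff (hT : IsPositiveOp T) {C : ℝ≥0∞} :
    C ≤ xNorm T γ ↔ ∀ P M : H →L[ℂ] H, 0 ≤ P → 0 ≤ M → γ = P - M →
      C ≤ formEnergy (oneAdd T) P + formEnergy (oneAdd T) M := by
  rw [← not_lt, xNorm_lt_iff hT]
  push Not
  rfl

theorem mem_XSpace_iff (hT : IsPositiveOp T) : γ ∈ XSpace T ↔ xNorm T γ < ∞ := by
  simp only [xNorm_lt_iff hT, XSpace, Set.mem_ofPred_eq, mem_XPos_iff hT, ENNReal.add_lt_top]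
  constructor
  · rintro ⟨P, ⟨hP, hEP⟩, M, ⟨hM, hEM⟩, hγ⟩
    exact ⟨P, M, hP, hM, hγ, hEP, hEM⟩
  · rintro ⟨P, M, hP, hM, hγ, hEP, hEM⟩
    exact ⟨P, ⟨hP, hEP⟩, M, ⟨hM, hEM⟩, hγ⟩

theorem xNorm_add_le (hT : IsPositiveOp T) (γ δ : H →L[ℂ] H) :
    xNorm T (γ + δ) ≤ xNorm T γ + xNorm T δ := by
  rw [← tsub_le_iff_right, le_xNorm_iff hT]
  rintro P M hP hM rfl
  rw [tsub_le_iff_left, ← tsub_le_iff_right, le_xNorm_iff hT]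
  rintro P' M' hP' hM' rfl
  rw [tsub_le_iff_right, sub_add_sub_comm]
  calc xNorm T (P + P' - (M + M'))
      ≤ formEnergy (oneAdd T) (P + P') + formEnergy (oneAdd T) (M + M') :=
        xNorm_sub_le hT (add_nonneg hP hP') (add_nonneg hM hM')
    _ ≤ formEnergy (oneAdd T) P + formEnergy (oneAdd T) P' +
          (formEnergy (oneAdd T) M + formEnergy (oneAdd T) M') :=
        add_le_add (formEnergy_add_le _ hP hP') (formEnergy_add_le _ hM hM')
    _ = _ := by abel

theorem xNorm_neg_le (hT : IsPositiveOp T) (γ : H →L[ℂ] H) : xNorm T (-γ) ≤ xNorm T γ := by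
  rw [le_xNorm_iff hT]
  rintro P M hP hM rfl
  rw [neg_sub, add_comm]
  exact xNorm_sub_le hT hM hP

theorem xNorm_smul_le_of_pos (hT : IsPositiveOp T) {r : ℝ} (hr : 0 < r) (γ : H →L[ℂ] H) :
    xNorm T (r • γ) ≤ ENNReal.ofReal r * xNorm T γ := by
  have hr' : ENNReal.ofReal r ≠ 0 := by simpa using hr
  rw [mul_comm, ← ENNReal.div_le_iff hr' ENNReal.ofReal_ne_top, le_xNorm_iff hT]
  rintro P M hP hM rfl
  rw [ENNReal.div_le_iff hr' ENNReal.ofReal_ne_top, smul_sub, mul_comm, mul_add,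
    ← formEnergy_smul _ hr.le, ← formEnergy_smul _ hr.le]
  exact xNorm_sub_le hT (smul_nonneg hr.le hP) (smul_nonneg hr.le hM)

theorem xNorm_smul_le (hT : IsPositiveOp T) (r : ℝ) (γ : H →L[ℂ] H) :
    xNorm T (r • γ) ≤ ENNReal.ofReal |r| * xNorm T γ := by
  rcases lt_trichotomy r 0 with hr | rfl | hr
  · rw [abs_of_neg hr, ← neg_neg r, neg_smul, neg_neg]
    exact (xNorm_neg_le hT _).trans (xNorm_smul_le_of_pos hT (neg_pos.mpr hr) γ)
  · have h := xNorm_sub_le hT (le_refl (0 : H →L[ℂ] H)) le_rfl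
    have hzero : formEnergy (oneAdd T) (0 : H →L[ℂ] H) = 0 := by
      simpa using formEnergy_smul (oneAdd T) le_rfl (0 : H →L[ℂ] H)
    simpa [hzero] using h
  · rw [abs_of_pos hr]
    exact xNorm_smul_le_of_pos hT hr γ

theorem ofReal_norm_le_xNorm (hT : IsPositiveOp T) (γ : H →L[ℂ] H) :
    ENNReal.ofReal ‖γ‖ ≤ xNorm T γ := by
  rw [le_xNorm_iff hT]
  rintro P M hP hM rfl
  calc ENNReal.ofReal ‖P - M‖ ≤ ENNReal.ofReal ‖P‖ + ENNReal.ofReal ‖M‖ :=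
        (ENNReal.ofReal_le_ofReal (norm_sub_le P M)).trans ENNReal.ofReal_add_le
    _ ≤ formEnergy (oneAdd T) P + formEnergy (oneAdd T) M := by
        gcongr
        · exact (ofReal_norm_le_posTrace hP).trans (posTrace_le_formEnergy_oneAdd hT hP)
        · exact (ofReal_norm_le_posTrace hM).trans (posTrace_le_formEnergy_oneAdd hT hM)

theorem isTraceClass_of_mem_XSpace (hγ : γ ∈ XSpace T) : IsTraceClass γ := by
  obtain ⟨P, ⟨hP, hP', -⟩, M, ⟨hM, hM', -⟩, rfl⟩ := hγ
  rw [← ContinuousLinearMap.nonneg_iff_isPositive] at hP hM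
  exact isTraceClass_sub_of_nonneg hP hM hP' hM'

theorem isSelfAdjoint_of_mem_XSpace (hγ : γ ∈ XSpace T) : IsSelfAdjoint γ := by
  obtain ⟨P, ⟨hP, -⟩, M, ⟨hM, -⟩, rfl⟩ := hγ
  exact hP.isSelfAdjoint.sub hM.isSelfAdjoint

end Energy

/-! ### Compactness in the weak operator topology -/

section WeakOperatorTopology

open ContinuousLinearMapWOT

variable {𝕜 E F : Type*} [RCLike 𝕜] [NormedAddCommGroup E] [NormedSpace 𝕜 E]
  [NormedAddCommGroup F] [InnerProductSpace 𝕜 F] [CompleteSpace F]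

theorem exists_inner_eq_of_sesquilinear (L : E →ₗ⋆[𝕜] F →ₗ[𝕜] 𝕜) {C : ℝ} (hC : 0 ≤ C)
    (hL : ∀ x y, ‖L x y‖ ≤ C * ‖x‖ * ‖y‖) :
    ∃ B : E →L[𝕜] F, ‖B‖ ≤ C ∧ ∀ x y, ⟪B x, y⟫_𝕜 = L x y := by
  let L' : E →L⋆[𝕜] StrongDual 𝕜 F := L.mkContinuous₂ C hL
  have hL' : ‖L'‖ ≤ C := L.mkContinuous₂_norm_le hC hL
  let B : E →L[𝕜] F :=
    (InnerProductSpace.toDual 𝕜 F).symm.toContinuousLinearEquiv.toContinuousLinearMap.comp L'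
  refine ⟨B, B.opNorm_le_bound hC fun x => ?_, fun x y => InnerProductSpace.toDual_symm_apply⟩
  calc ‖B x‖ = ‖L' x‖ := (InnerProductSpace.toDual 𝕜 F).symm.norm_map (L' x)
    _ ≤ C * ‖x‖ := L'.le_of_opNorm_le hL' x

theorem exists_tendsto_inner_of_norm_le {ι : Type*} (U : Ultrafilter ι) {A : ι → E →L[𝕜] F}
    {C : ℝ} (hA : ∀ᶠ i in U, ‖A i‖ ≤ C) :
    ∃ B : E →L[𝕜] F, ‖B‖ ≤ C ∧ ∀ x y, Tendsto (fun i => ⟪A i x, y⟫_𝕜) U (𝓝 ⟪B x, y⟫_𝕜) := by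
  have hlim (x : E) (y : F) : ∃ z ∈ Metric.closedBall (0 : 𝕜) (C * ‖x‖ * ‖y‖),
      Tendsto (fun i => ⟪A i x, y⟫_𝕜) U (𝓝 z) := by
    refine (isCompact_closedBall (0 : 𝕜) _).ultrafilter_le_nhds (U.map fun i => ⟪A i x, y⟫_𝕜) ?_
    rw [le_principal_iff, Ultrafilter.coe_map, mem_map]
    filter_upwards [hA] with i hi
    rw [Set.mem_preimage, mem_closedBall_zero_iff]
    exact (norm_inner_le_norm _ _).trans (by gcongr; exact (A i).le_of_opNorm_le hi x)
  choose L hL hLt using hlim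
  let L' : E →ₗ⋆[𝕜] F →ₗ[𝕜] 𝕜 := LinearMap.mk₂'ₛₗ (starRingEnd 𝕜) (RingHom.id 𝕜) L
    (fun x x' y => tendsto_nhds_unique (hLt _ _) <| by
      simpa [inner_add_left] using (hLt x y).add (hLt x' y))
    (fun c x y => tendsto_nhds_unique (hLt _ _) <| by
      simpa [inner_smul_left] using (hLt x y).const_mul (starRingEnd 𝕜 c))
    (fun x y y' => tendsto_nhds_unique (hLt _ _) <| by
      simpa [inner_add_right] using (hLt x y).add (hLt x y'))
    (fun c x y => tendsto_nhds_unique (hLt _ _) <| by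
      simpa [inner_smul_right] using (hLt x y).const_mul c)
  obtain ⟨i, hi⟩ := hA.exists
  obtain ⟨B, hB, hBL⟩ := exists_inner_eq_of_sesquilinear L' ((norm_nonneg _).trans hi)
    fun x y => mem_closedBall_zero_iff.mp (hL x y)
  exact ⟨B, hB, fun x y => (hBL x y).symm ▸ hLt x y⟩

theorem isCompact_setOf_norm_toCLM_le (C : ℝ) :
    IsCompact {A : E →WOT[𝕜] F | ‖A.toCLM‖ ≤ C} := by
  refine isCompact_iff_ultrafilter_le_nhds.mpr fun U hU => ?_
  obtain ⟨B, hB, hlim⟩ := exists_tendsto_inner_of_norm_le U (A := toCLM) (le_principal_iff.mp hU)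
  refine ⟨ofCLM B, hB, le_nhds_iff_forall_inner_apply_le_nhds.mpr fun x y => ?_⟩
  have hconj := (RCLike.continuous_conj.tendsto _).comp (hlim x y)
  simp only [Function.comp_def, inner_conj_symm] at hconj
  exact hconj

end WeakOperatorTopology

/-! ### Lower semicontinuity of the `X`-norm -/

section LowerSemicontinuity

open ContinuousLinearMapWOT

variable {H : Type*} [NormedAddCommGroup H] [InnerProductSpace ℂ H] [CompleteSpace H]
variable {T : H →ₗ.[ℂ] H}

theorem lowerSemicontinuous_posTraceMul_toCLM (B : H →L[ℂ] H) :
    LowerSemicontinuous fun A : H →WOT[ℂ] H => posTraceMul B A.toCLM := by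
  refine lowerSemicontinuous_tsum fun i => Continuous.lowerSemicontinuous ?_
  have hroot (A : H →WOT[ℂ] H) (x : H) : ⟪x, (CFC.sqrt B * A.toCLM * CFC.sqrt B) x⟫_ℂ =
      ⟪CFC.sqrt B x, A (CFC.sqrt B x)⟫_ℂ :=
    ((CFC.sqrt_nonneg B).isSelfAdjoint.isSymmetric x _).symm
  simp only [hroot]
  exact ENNReal.continuous_ofReal.comp (RCLike.continuous_re.comp
    (continuous_iff.mp continuous_id _ _))

theorem lowerSemicontinuous_formEnergy_toCLM (T : H →ₗ.[ℂ] H) :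
    LowerSemicontinuous fun A : H →WOT[ℂ] H => formEnergy T A.toCLM :=
  lowerSemicontinuous_biSup fun _ _ => lowerSemicontinuous_posTraceMul_toCLM _

theorem isClosed_setOf_nonneg_toCLM : IsClosed {A : H →WOT[ℂ] H | 0 ≤ A.toCLM} := by
  simp only [ContinuousLinearMap.nonneg_iff_isPositive, ContinuousLinearMap.isPositive_iff_complex,
    Set.ofPred_forall]
  refine isClosed_iInter fun x => ?_
  have hx : Continuous fun A : H →WOT[ℂ] H => ⟪A x, x⟫_ℂ := by
    simpa only [Function.comp_def, id, inner_conj_symm] using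
      RCLike.continuous_conj.comp (continuous_iff.mp continuous_id x x)
  have hre := RCLike.continuous_re.comp hx
  exact (isClosed_eq (Complex.continuous_ofReal.comp hre) hx).inter
    (isClosed_le continuous_const hre)

theorem isCompact_setOf_formEnergy_add_le (hT : IsPositiveOp T) {C : ℝ≥0∞} (hC : C ≠ ∞) :
    IsCompact {A : (H →WOT[ℂ] H) × (H →WOT[ℂ] H) | 0 ≤ A.1.toCLM ∧ 0 ≤ A.2.toCLM ∧
      formEnergy (oneAdd T) A.1.toCLM + formEnergy (oneAdd T) A.2.toCLM ≤ C} := by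
  have hbdd {A : H →WOT[ℂ] H} (hA : 0 ≤ A.toCLM) (hE : formEnergy (oneAdd T) A.toCLM ≤ C) :
      ‖A.toCLM‖ ≤ C.toReal :=
    (ENNReal.ofReal_le_iff_le_toReal hC).mp <|
      (ofReal_norm_le_posTrace hA).trans ((posTrace_le_formEnergy_oneAdd hT hA).trans hE)
  have hE := lowerSemicontinuous_formEnergy_toCLM (oneAdd T)
  refine ((isCompact_setOf_norm_toCLM_le C.toReal).prod
    (isCompact_setOf_norm_toCLM_le C.toReal)).of_isClosed_subset ?_
    fun A hA => ⟨hbdd hA.1 (le_self_add.trans hA.2.2), hbdd hA.2.1 (le_add_self.trans hA.2.2)⟩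
  exact (isClosed_setOf_nonneg_toCLM.preimage continuous_fst).inter <|
    (isClosed_setOf_nonneg_toCLM.preimage continuous_snd).inter <|
      ((hE.comp continuous_fst).add (hE.comp continuous_snd)).isClosed_preimage C

theorem xNorm_le_iff_forall_exists (hT : IsPositiveOp T) {C : ℝ≥0∞} {γ : H →L[ℂ] H} :
    xNorm T γ ≤ C ↔ ∀ C', C < C' → C' ≠ ∞ → ∃ P M : H →L[ℂ] H, 0 ≤ P ∧ 0 ≤ M ∧ γ = P - M ∧
      formEnergy (oneAdd T) P + formEnergy (oneAdd T) M ≤ C' := by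
  constructor
  · intro h C' hCC' _
    obtain ⟨P, M, hP, hM, hγ, hE⟩ := (xNorm_lt_iff hT).mp (h.trans_lt hCC')
    exact ⟨P, M, hP, hM, hγ, hE.le⟩
  · intro h
    refine le_of_forall_gt_imp_ge_of_dense fun D hD => ?_
    obtain ⟨C', hCC', hC'⟩ := exists_between hD
    obtain ⟨P, M, hP, hM, rfl, hE⟩ := h C' hCC' hC'.ne_top
    exact (xNorm_sub_le hT hP hM).trans (hE.trans hC'.le)

theorem lowerSemicontinuous_xNorm_toCLM (hT : IsPositiveOp T) :
    LowerSemicontinuous fun A : H →WOT[ℂ] H => xNorm T A.toCLM := by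
  refine lowerSemicontinuous_iff_isClosed_preimage.mpr fun C => ?_
  have hsublevel : (fun A : H →WOT[ℂ] H => xNorm T A.toCLM) ⁻¹' Set.Iic C =
      ⋂ (C' : ℝ≥0∞) (_ : C < C') (_ : C' ≠ ∞),
        (fun A : (H →WOT[ℂ] H) × (H →WOT[ℂ] H) => A.1 - A.2) ''
          {A | 0 ≤ A.1.toCLM ∧ 0 ≤ A.2.toCLM ∧
            formEnergy (oneAdd T) A.1.toCLM + formEnergy (oneAdd T) A.2.toCLM ≤ C'} := by
    ext A
    simp only [Set.mem_preimage, Set.mem_Iic, xNorm_le_iff_forall_exists hT, Set.mem_iInter]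
    refine forall₃_congr fun C' _ _ => ⟨?_, ?_⟩
    · rintro ⟨P, M, hP, hM, hA, hE⟩
      exact ⟨(ofCLM P, ofCLM M), ⟨hP, hM, hE⟩, toCLM_injective hA.symm⟩
    · rintro ⟨⟨P, M⟩, ⟨hP, hM, hE⟩, rfl⟩
      exact ⟨P.toCLM, M.toCLM, hP, hM, rfl, hE⟩
  rw [hsublevel]
  exact isClosed_iInter fun C' => isClosed_iInter fun _ => isClosed_iInter fun hC' =>
    ((isCompact_setOf_formEnergy_add_le hT hC').image continuous_sub).isClosed

end LowerSemicontinuity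

/-! ### The weak-* topology on trace class operators -/

section WeakStar

open ContinuousLinearMapWOT

variable {H : Type*} [NormedAddCommGroup H] [InnerProductSpace ℂ H] [CompleteSpace H]

theorem trace_rankOne_comp (x y : H) (D : H →L[ℂ] H) :
    trace (InnerProductSpace.rankOne ℂ y x ∘L D) = ⟪x, D y⟫_ℂ := by
  rw [← ContinuousLinearMap.adjoint_inner_left,
    ← ((stdBasis H).hasSum_inner_mul_inner (ContinuousLinearMap.adjoint D x) y).tsum_eq]
  refine tsum_congr fun i => ?_
  rw [ContinuousLinearMap.comp_apply, InnerProductSpace.rankOne_apply, inner_smul_right,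
    ContinuousLinearMap.adjoint_inner_left]

theorem isCompactOperator_rankOne {𝕜 E F : Type*} [RCLike 𝕜] [NormedAddCommGroup E]
    [InnerProductSpace 𝕜 E] [NormedAddCommGroup F] [InnerProductSpace 𝕜 F] (y : F) (x : E) :
    IsCompactOperator (InnerProductSpace.rankOne 𝕜 y x) :=
  (isCompactOperator_of_locallyCompactSpace_rng (ContinuousLinearMap.toSpanSingleton 𝕜 y)).comp_clm
    (innerSL 𝕜 x)

theorem TraceClass.continuous_trace_comp {V : H →L[ℂ] H} (hV : IsCompactOperator V) :
    Continuous fun A : TraceClass H => trace (V ∘L A.op) := by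
  have h : Continuous fun (A : TraceClass H) (W : {W : H →L[ℂ] H // IsCompactOperator W}) =>
      trace ((W : H →L[ℂ] H) ∘L A.op) := continuous_induced_dom
  exact continuous_pi_iff.mp h ⟨V, hV⟩

theorem TraceClass.continuous_ofCLM_op :
    Continuous fun A : TraceClass H => (ofCLM A.op : H →WOT[ℂ] H) := by
  refine continuous_iff.mpr fun x y => ?_
  simpa only [trace_rankOne_comp, ofCLM_apply] using
    TraceClass.continuous_trace_comp (isCompactOperator_rankOne x y)

theorem tendsto_ofCLM_of_tendsto_trace {ι : Type*} {l : Filter ι} {A : ι → H →L[ℂ] H}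
    {B : H →L[ℂ] H} (h : ∀ V : H →L[ℂ] H, IsCompactOperator V →
      Tendsto (fun i => trace (V ∘L (A i - B))) l (𝓝 0)) :
    Tendsto (fun i => (ofCLM (A i) : H →WOT[ℂ] H)) l (𝓝 (ofCLM B)) := by
  refine tendsto_iff_forall_inner_apply_tendsto.mpr fun x y => tendsto_sub_nhds_zero_iff.mp ?_
  simpa only [trace_rankOne_comp, _root_.sub_apply, inner_sub_right, ofCLM_apply] using
    h _ (isCompactOperator_rankOne x y)

end WeakStar

/-! ### Banach spaces from extended seminorms -/

theorem completeSpace_ofCore {E : Type*} [AddCommGroup E] [Module ℝ E] [Norm E]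
    (core : NormedSpace.Core ℝ E)
    (h : ∀ u : ℕ → E,
      (∀ ε > 0, ∃ n₀, ∀ m ≥ n₀, ∀ n ≥ n₀, ENNReal.ofReal ‖u m - u n‖ < ε) →
      ∃ x, ∀ ε > 0, ∃ n₀, ∀ n ≥ n₀, ENNReal.ofReal ‖u n - x‖ ≤ ε) :
    letI : NormedAddCommGroup E := NormedAddCommGroup.ofCore core
    CompleteSpace E := by
  let : NormedAddCommGroup E := NormedAddCommGroup.ofCore core
  refine EMetric.complete_of_cauchySeq_tendsto fun u hu => ?_
  simp only [EMetric.cauchySeq_iff, edist_eq_enorm_sub, ← ofReal_norm] at hu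
  obtain ⟨x, hx⟩ := h u hu
  refine ⟨x, EMetric.tendsto_atTop.mpr fun ε hε => ?_⟩
  obtain ⟨δ, hδ, hδε⟩ := exists_between hε
  simp only [edist_eq_enorm_sub, ← ofReal_norm]
  exact (hx δ hδ).imp fun n₀ h n hn => (h n hn).trans_lt hδε

theorem exists_forall_le_of_lowerSemicontinuous {E : Type*} [NormedAddCommGroup E] [CompleteSpace E]
    {N : E → ℝ≥0∞}
    (hle : ∀ x, ENNReal.ofReal ‖x‖ ≤ N x) (hlsc : LowerSemicontinuous N) {u : ℕ → E}
    (hu : ∀ ε > 0, ∃ n₀, ∀ m ≥ n₀, ∀ n ≥ n₀, N (u m - u n) < ε) :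
    ∃ x, ∀ ε > 0, ∃ n₀, ∀ n ≥ n₀, N (u n - x) ≤ ε := by
  have hcauchy : CauchySeq u := by
    refine EMetric.cauchySeq_iff.mpr fun ε hε => (hu ε hε).imp fun n₀ h m hm n hn => ?_
    rw [edist_eq_enorm_sub, ← ofReal_norm]
    exact (hle _).trans_lt (h m hm n hn)
  obtain ⟨x, hx⟩ := cauchySeq_tendsto_of_complete hcauchy
  refine ⟨x, fun ε hε => (hu ε hε).imp fun n₀ h n hn => ?_⟩
  exact (hlsc.isClosed_preimage ε).mem_of_tendsto (hx.const_sub (u n))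
    ((eventually_ge_atTop n₀).mono fun m hm => (h n hn m hm).le)

/-- An extended seminorm on a real vector space: a subadditive and absolutely homogeneous function
which may take the value `∞`. Homogeneity is encoded as an inequality, which also forces `N 0 = 0`;
the equality is `IsExtendedSeminorm.map_smul`. -/
structure IsExtendedSeminorm {E : Type*} [AddCommGroup E] [Module ℝ E] (N : E → ℝ≥0∞) :
    Prop where
  add_le : ∀ x y, N (x + y) ≤ N x + N y
  smul_le : ∀ (r : ℝ) (x : E), N (r • x) ≤ ENNReal.ofReal |r| * N x

namespace IsExtendedSeminorm

variable {E : Type*} [AddCommGroup E] [Module ℝ E] {N : E → ℝ≥0∞}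

theorem map_zero (hN : IsExtendedSeminorm N) : N 0 = 0 := by
  simpa using hN.smul_le 0 0

theorem map_smul (hN : IsExtendedSeminorm N) (r : ℝ) (x : E) :
    N (r • x) = ENNReal.ofReal |r| * N x := by
  rcases eq_or_ne r 0 with rfl | hr
  · simp [hN.map_zero]
  refine (hN.smul_le r x).antisymm ?_
  have h := hN.smul_le r⁻¹ (r • x)
  rw [inv_smul_smul₀ hr, abs_inv, ENNReal.ofReal_inv_of_pos (abs_pos.mpr hr)] at h
  rwa [mul_comm, ← ENNReal.le_div_iff_mul_le (by simp [hr]) (by simp), ENNReal.div_eq_inv_mul]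

/-- The subspace on which an extended seminorm is finite. -/
def finiteSubmodule (hN : IsExtendedSeminorm N) : Submodule ℝ E where
  carrier := {x | N x < ∞}
  add_mem' hx hy := (hN.add_le _ _).trans_lt (ENNReal.add_lt_top.mpr ⟨hx, hy⟩)
  zero_mem' := hN.map_zero.trans_lt ENNReal.zero_lt_top
  smul_mem' r x hx := (hN.smul_le r x).trans_lt (ENNReal.mul_lt_top ENNReal.ofReal_lt_top hx)

theorem normedSpaceCore (hN : IsExtendedSeminorm N) (hdef : ∀ x, N x = 0 → x = 0) :
    letI : Norm hN.finiteSubmodule := ⟨fun x => (N x).toReal⟩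
    NormedSpace.Core ℝ hN.finiteSubmodule := by
  let : Norm hN.finiteSubmodule := ⟨fun x => (N x).toReal⟩
  have hfin (x : hN.finiteSubmodule) : N x ≠ ∞ := ne_of_lt x.2
  refine { norm_nonneg := fun _ => ENNReal.toReal_nonneg, norm_smul := fun r x => ?_,
           norm_triangle := fun x y => ?_, norm_eq_zero_iff := fun x => ?_ }
  · change (N (r • (x : E))).toReal = ‖r‖ * (N x).toReal
    rw [hN.map_smul, ENNReal.toReal_mul, ENNReal.toReal_ofReal (abs_nonneg r), Real.norm_eq_abs]
  · change (N (x + y : E)).toReal ≤ (N x).toReal + (N y).toReal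
    rw [← ENNReal.toReal_add (hfin x) (hfin y)]
    exact ENNReal.toReal_mono (ENNReal.add_ne_top.mpr ⟨hfin x, hfin y⟩) (hN.add_le x y)
  · change (N x).toReal = 0 ↔ x = 0
    rw [ENNReal.toReal_eq_zero_iff, or_iff_left (hfin x), ← Submodule.coe_eq_zero]
    exact ⟨hdef x, fun h => h ▸ hN.map_zero⟩

theorem isRealBanachSpace {E : Type*} [NormedAddCommGroup E] [NormedSpace ℝ E] [CompleteSpace E]
    {N : E → ℝ≥0∞} (hN : IsExtendedSeminorm N) (hle : ∀ x, ENNReal.ofReal ‖x‖ ≤ N x)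
    (hlsc : LowerSemicontinuous N) : IsRealBanachSpace {x | N x < ∞} N := by
  have hdef (x : E) (hx : N x = 0) : x = 0 := by simpa [hx] using hle x
  let : Norm hN.finiteSubmodule := ⟨fun x => (N x).toReal⟩
  have core : NormedSpace.Core ℝ hN.finiteSubmodule := hN.normedSpaceCore hdef
  refine ⟨hN.finiteSubmodule, rfl, fun x hx => hx, core, completeSpace_ofCore core fun u hu => ?_⟩
  have hnorm (x : hN.finiteSubmodule) : ENNReal.ofReal ‖x‖ = N x :=
    ENNReal.ofReal_toReal (ne_of_lt x.2)
  simp only [hnorm] at hu ⊢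
  obtain ⟨x, hx⟩ := exists_forall_le_of_lowerSemicontinuous hle hlsc hu
  have hxS : x ∈ hN.finiteSubmodule := by
    obtain ⟨n₀, h⟩ := hx 1 one_pos
    have hsub : (u n₀ : E) - x ∈ hN.finiteSubmodule := (h n₀ le_rfl).trans_lt ENNReal.one_lt_top
    exact (Submodule.sub_mem_iff_right _ (u n₀).2).mp hsub
  exact ⟨⟨x, hxS⟩, hx⟩

end IsExtendedSeminorm

section XSpace

variable {H : Type*} [NormedAddCommGroup H] [InnerProductSpace ℂ H] [CompleteSpace H]
variable {T : H →ₗ.[ℂ] H}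

theorem isExtendedSeminorm_xNorm (hT : IsPositiveOp T) : IsExtendedSeminorm (xNorm T) :=
  ⟨xNorm_add_le hT, xNorm_smul_le hT⟩

theorem isRealBanachSpace_XSpace (hT : IsPositiveOp T) :
    IsRealBanachSpace (XSpace T) (xNorm T) := by
  have hX : XSpace T = {γ | xNorm T γ < ∞} := Set.ext fun _ => mem_XSpace_iff hT
  rw [hX]
  exact (isExtendedSeminorm_xNorm hT).isRealBanachSpace (ofReal_norm_le_xNorm hT)
    ((lowerSemicontinuous_xNorm_toCLM hT).comp ContinuousLinearMapWOT.continuous_ofCLM)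

end XSpace

end RDM

end

theorem mainTheorem4_general {H : Type*} [NormedAddCommGroup H] [InnerProductSpace ℂ H]
    [CompleteSpace H] (T : H →ₗ.[ℂ] H) (hT : RDM.IsPositiveOp T) :
    LowerSemicontinuous (fun γ : RDM.TraceClass H => RDM.xNorm T γ.op) ∧
    (∀ (γs : ℕ → RDM.TraceClass H) (γ : RDM.TraceClass H),
      (∀ V : H →L[ℂ] H, IsCompactOperator V →
        Tendsto (fun n => RDM.trace (V ∘L ((γs n).op - γ.op))) atTop (𝓝 0)) →
      RDM.xNorm T γ.op ≤ liminf (fun n => RDM.xNorm T (γs n).op) atTop) ∧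
    (∀ γ ∈ RDM.XSpace T, RDM.IsTraceClass γ ∧ IsSelfAdjoint γ) ∧
    RDM.IsRealBanachSpace (RDM.XSpace T) (RDM.xNorm T) := by
  have hlsc := RDM.lowerSemicontinuous_xNorm_toCLM hT
  refine ⟨hlsc.comp RDM.TraceClass.continuous_ofCLM_op, fun γs γ h => ?_,
    fun γ hγ => ⟨RDM.isTraceClass_of_mem_XSpace hγ, RDM.isSelfAdjoint_of_mem_XSpace hγ⟩,
    RDM.isRealBanachSpace_XSpace hT⟩
  have hWOT := RDM.tendsto_ofCLM_of_tendsto_trace h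
  exact (hlsc.lowerSemicontinuousAt _).le_liminf.trans hWOT.liminf_le_liminf_comp

theorem mainTheorem4 {H : Type*} [NormedAddCommGroup H] [InnerProductSpace ℂ H] [CompleteSpace H]
    [TopologicalSpace.SeparableSpace H] (T : H →ₗ.[ℂ] H) (hT : RDM.IsPositiveOp T) :
    LowerSemicontinuous (fun γ : RDM.TraceClass H => RDM.xNorm T γ.op) ∧
    (∀ (γs : ℕ → RDM.TraceClass H) (γ : RDM.TraceClass H),
      (∀ V : H →L[ℂ] H, IsCompactOperator V →
        Tendsto (fun n => RDM.trace (V ∘L ((γs n).op - γ.op))) atTop (𝓝 0)) →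
      RDM.xNorm T γ.op ≤ liminf (fun n => RDM.xNorm T (γs n).op) atTop) ∧
    (∀ γ ∈ RDM.XSpace T, RDM.IsTraceClass γ ∧ IsSelfAdjoint γ) ∧
    RDM.IsRealBanachSpace (RDM.XSpace T) (RDM.xNorm T) :=
  mainTheorem4_general T hT
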